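/- **Conventions.** Composition is written from left to right. A *category with subobjects* is a small category $\mathcal C$ with a wide subcategory of morphisms, called *inclusions*, which is a strict preorder (at most one inclusion between two objects, written $j(c,d)\colon c\subseteq d$, and $c\subseteq d\subseteq c$ implies $c=d$), such that every inclusion is a monomorphism and $h$ is an inclusion whenever $hg$ and $g$ are. A *retraction* is a $q\colon c\to c'$ with $j(c',c)q=1_{c'}$ for some $c'\subseteq c$. A *normal factorization* of $f$ is $f=quj$ with $q$ a retraction, $u$ an isomorphism, $j$ an inclusion; $f^\circ=qu$ is the *epimorphic component*. A *normal cone* $\gamma$ with apex $c_\gamma$ is a family $\gamma(c)\colon c\to c_\gamma$ ($c\in v\mathcal C$) with $j(c,c')\gamma(c')=\gamma(c)$ for $c\subseteq c'$ and some $\gamma(c)$ an isomorphism; put $M\gamma=\{c:\gamma(c)\text{ is an isomorphism}\}$, and for an epimorphism $p$ with domain $c_\gamma$ let $\gamma*p$ be the cone $a\mapsto\gamma(a)p$. $\mathcal C$ is *normal* if every morphism has a normal factorization, every inclusion splits, and every object $c$ is the apex of a normal cone $\gamma$ with $\gamma(c)=1_c$. For a normal cone $\gamma$ in a normal category $\mathcal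 C$, the *H-functor* $H(\gamma;-)\colon\mathcal C\to\mathbf{Set}$ is $H(\gamma;c)=\{\gamma*f^\circ: f\in\mathcal C(c_\gamma,c)\}$, $H(\gamma;g)\colon\gamma*f^\circ\mapsto\gamma*(fg)^\circ$; $\eta_\gamma\colon H(\gamma;-)\to\mathcal C(c_\gamma,-)$, $\gamma*f^\circ\mapsto f$, is a natural isomorphism. Put $MH(\gamma;-)=M\gamma$. The *normal dual* $N^*\mathcal C$ is the full subcategory of $[\mathcal C,\mathbf{Set}]$ on the H-functors; its inclusions are the inclusions of functors (all components are inclusions of sets). The *ideal* $\langle c\rangle$ is the full subcategory on the objects $d\subseteq c$. A functor $F$ between normal categories is a *local isomorphism* if it preserves inclusions, is fully faithful, and restricts for each object $c$ to an isomorphism of $\langle c\rangle$ onto $\langle F(c)\rangle$. For normal categories $\mathcal D,\mathcal C$, a functor $\Gamma\colon\mathcal D\to N^*\mathcal C$ is a *cross-connection* if it is a local isomorphism and every $c\in v\mathcal C$ lies in $M\Gamma(d)$ for some $d\in v\mathcal D$. Let $S$ be a regular semigroup, $E$ its set of idempotents, and $\mathcal G(S)$ its groupoid: the objects are the elements of $E$,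 and the morphisms $e\to f$ are the pairs $(x,x')$ of mutually inverse elements with $xx'=e$, $x'x=f$. Write $e\,\omega^l f$ if $ef=e$, $e\,\omega^r f$ if $fe=e$, $\omega=\omega^l\cap\omega^r$, $\mathscr L=\omega^l\cap(\omega^l)^{-1}$, $\mathscr R=\omega^r\cap(\omega^r)^{-1}$, and $\overleftarrow e$, $\overrightarrow e$ for the $\mathscr L$- and $\mathscr R$-class of $e$ in $E$. The category $\mathcal L_G$ has object set $E/\mathscr L$. Its morphisms are those of the free category on the quiver with the arrows $r(e,u,f)\colon\overleftarrow e\to\overleftarrow f$ where either $u=e\,\omega^l f$, or $u\in E$ with $u\,\mathscr L\,f$ and $u\,\omega\,e$, or $(u,u')\colon e\to f$ is a morphism of $\mathcal G(S)$ for some $u'$; they are composed by $r(e,u,f)\,r(g,v,h)=r(e,uv,h)$ for $f\mathrel{\mathscr L}g$, the empty path at $\overleftarrow e$ being $r(e,e,e)$, and identified by $r(e,u,f)\sim r(g,v,h)\iff e\mathrel{\mathscr L}g,\ f\mathrel{\mathscr L}h,\ u=ev$. There is a morphism $r(e,u,f)$ for every $u\in eSf$. The inclusions are the $r(e,e,f)$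 with $e\,\omega^l f$. The category $\mathcal R_G$, with object set $E/\mathscr R$, morphisms $l(e,u,f)\colon\overrightarrow e\to\overrightarrow f$ ($u\in fSe$), composition $l(e,u,f)\,l(f,v,g)=l(e,vu,g)$ and inclusions $l(e,e,f)$ for $e\,\omega^r f$, is constructed dually, i.e. by the same construction from the opposite semigroup. For $e\in E$ let $r^e$ be the normal cone in $\mathcal L_G$ with apex $\overleftarrow e$ and $r^e(\overleftarrow g)=r(g,ge,e)$. **Theorem.** Let $S$ be a regular semigroup. There is exactly one functor $\Gamma_G\colon\mathcal R_G\to N^*\mathcal L_G$ such that $$\Gamma_G(\overrightarrow e)=H(r^e;-)\quad\text{and}\quad \Gamma_G(l(e,u,f))=\eta_{r^e}\,\mathcal L_G(r(f,u,e),-)\,\eta_{r^f}^{-1}$$ for all $e,f\in E$ and $u\in fSe$. This functor is a cross-connection: $\mathcal R_G$, $\mathcal L_G$ and $N^*\mathcal L_G$ are normal categories, $\Gamma_G$ is a local isomorphism, and every object of $\mathcal L_G$ lies in $M\Gamma_G(\overrightarrow e)$ for some $e\in E$. -/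

import Mathlib

open CategoryTheory

universe u

noncomputable section

namespace CrossConn

/-! ### Categories with subobjects and normal categories -/

/-- A category with a distinguished class of morphisms, the inclusions. -/
class HasInclusions (C : Type u) [SmallCategory C] where
  incl : MorphismProperty C

section General

variable {C : Type u} [SmallCategory C] [HasInclusions C]

/-- `IsIncl j`: the morphism `j` belongs to the distinguished class. -/
def IsIncl {c d : C} (j : c ⟶ d) : Prop := HasInclusions.incl j

/-- `Sub c d` is the relation `c ⊆ d`: there is an inclusion from `c` to `d`. -/
def Sub (c d : C) : Prop := ∃ j : c ⟶ d, IsIncl j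

/-- `q : c ⟶ c'` is a retraction: it splits an inclusion `c' ⊆ c`. -/
def IsRetraction {c c' : C} (q : c ⟶ c') : Prop := ∃ i : c' ⟶ c, IsIncl i ∧ i ≫ q = 𝟙 c'

variable (C) in
/-- A category with subobjects: the inclusions form a wide subcategory which is a strict
preorder, every inclusion is a monomorphism, and `h` is an inclusion as soon as `g` and
`h ≫ g` are. -/
class IsCatWithSubobjects : Prop where
  id_mem : ∀ c : C, IsIncl (𝟙 c)
  comp_mem : ∀ {a b c : C} (f : a ⟶ b) (g : b ⟶ c), IsIncl f → IsIncl g → IsIncl (f ≫ g)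
  unique : ∀ {a b : C} (f g : a ⟶ b), IsIncl f → IsIncl g → f = g
  strict : ∀ {a b : C} (f : a ⟶ b) (g : b ⟶ a), IsIncl f → IsIncl g → a = b
  mono : ∀ {a b : C} (f : a ⟶ b), IsIncl f → Mono f
  of_comp : ∀ {a b c : C} (h : a ⟶ b) (g : b ⟶ c), IsIncl (h ≫ g) → IsIncl g → IsIncl h

/-- A normal factorization `f = q u j`: a retraction, an isomorphism and an inclusion. -/
structure NormalFactorization {c d : C} (f : c ⟶ d) where
  mid : C
  im : C
  q : c ⟶ mid
  u : mid ⟶ im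
  j : im ⟶ d
  retraction : IsRetraction q
  iso : IsIso u
  inclusion : IsIncl j
  fac : q ≫ u ≫ j = f

variable (C) in
/-- A normal cone with base `C` and the given apex. -/
@[ext]
structure NormalCone where
  apex : C
  app : ∀ c : C, c ⟶ apex
  incl_comp : ∀ {c c' : C} (j : c ⟶ c'), IsIncl j → j ≫ app c' = app c
  exists_iso : ∃ c : C, IsIso (app c)

variable (C) in
/-- Normal categories. -/
class IsNormalCategory : Prop extends IsCatWithSubobjects C where
  factorization : ∀ {c d : C} (f : c ⟶ d), Nonempty (NormalFactorization f)
  splits : ∀ {c d : C} (j : c ⟶ d), IsIncl j → ∃ q : d ⟶ c, j ≫ q = 𝟙 c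
  cone : ∀ c : C, ∃ (γ : NormalCone C) (h : γ.apex = c), γ.app c = eqToHom h.symm

/-- The `M`-set of a normal cone. -/
def NormalCone.M (γ : NormalCone C) : Set C := {c | IsIso (γ.app c)}

section Normal

variable [IsNormalCategory C]

/-- A chosen normal factorization; its epimorphic component and its inclusion do not depend on
the choice, see `factor_unique`. -/
def factorOf {c d : C} (f : c ⟶ d) : NormalFactorization f :=
  (IsNormalCategory.factorization f).some

/-- The codomain of the epimorphic component of `f`. -/
abbrev im {c d : C} (f : c ⟶ d) : C := (factorOf f).im

/-- The epimorphic component `f° = q u` of `f = q u j`. -/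
def epiPart {c d : C} (f : c ⟶ d) : c ⟶ im f := (factorOf f).q ≫ (factorOf f).u

/-- The inclusion `j` of `f = f° j`. -/
def imIncl {c d : C} (f : c ⟶ d) : im f ⟶ d := (factorOf f).j

theorem epiPart_comp {c d : C} (f : c ⟶ d) : epiPart f ≫ imIncl f = f := by
  rw [epiPart, imIncl, Category.assoc]
  exact (factorOf f).fac

theorem imIncl_incl {c d : C} (f : c ⟶ d) : IsIncl (imIncl f) := (factorOf f).inclusion

theorem epiPart_split {c d : C} (f : c ⟶ d) : ∃ s : im f ⟶ c, s ≫ epiPart f = 𝟙 (im f) := by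
  obtain ⟨i, _, hi⟩ := (factorOf f).retraction
  have := (factorOf f).iso
  refine ⟨inv (factorOf f).u ≫ i, ?_⟩
  rw [epiPart, Category.assoc, reassoc_of% hi, IsIso.inv_hom_id]

instance epiPart_epi {c d : C} (f : c ⟶ d) : Epi (epiPart f) := by
  obtain ⟨s, hs⟩ := epiPart_split f
  exact ⟨fun g h e => by
    have := congrArg (fun t => s ≫ t) e
    simpa [reassoc_of% hs] using this⟩

/-- A factorization as a split epimorphism followed by an inclusion is unique. -/
theorem factor_unique {c d a b : C} (p : c ⟶ a) (j : a ⟶ d) (p' : c ⟶ b) (j' : b ⟶ d)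
    (hp : ∃ s, s ≫ p = 𝟙 a) (hp' : ∃ s, s ≫ p' = 𝟙 b) (hj : IsIncl j) (hj' : IsIncl j')
    (e : p ≫ j = p' ≫ j') : ∃ h : a = b, p ≫ eqToHom h = p' ∧ j = eqToHom h ≫ j' := by
  obtain ⟨s, hs⟩ := hp
  obtain ⟨s', hs'⟩ := hp'
  have h1 : (s ≫ p') ≫ j' = j := by rw [Category.assoc, ← e, reassoc_of% hs]
  have h2 : (s' ≫ p) ≫ j = j' := by rw [Category.assoc, e, reassoc_of% hs']
  have i1 : IsIncl (s ≫ p') := IsCatWithSubobjects.of_comp _ j' (by rw [h1]; exact hj) hj'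
  have i2 : IsIncl (s' ≫ p) := IsCatWithSubobjects.of_comp _ j (by rw [h2]; exact hj') hj
  obtain rfl := IsCatWithSubobjects.strict _ _ i1 i2
  obtain rfl := IsCatWithSubobjects.unique _ _ hj hj'
  have := IsCatWithSubobjects.mono j hj
  exact ⟨rfl, by simpa using (cancel_mono j).1 e, by simp⟩

/-- For a normal cone `γ` and an epimorphism `p` from its apex, the normal cone
`γ * p : a ↦ γ(a) p`. -/
def NormalCone.star (γ : NormalCone C) {d : C} (p : γ.apex ⟶ d) [Epi p] : NormalCone C where
  apex := d
  app c := γ.app c ≫ p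
  incl_comp j hj := by rw [← Category.assoc, γ.incl_comp j hj]
  exists_iso := by
    obtain ⟨c, hc⟩ := γ.exists_iso
    obtain ⟨s, hs⟩ : ∃ s : d ⟶ γ.apex, s ≫ p = 𝟙 d := by
      obtain ⟨r, hr⟩ := IsNormalCategory.splits _ (imIncl_incl p)
      obtain ⟨s, hs⟩ := epiPart_split p
      refine ⟨r ≫ s, ?_⟩
      have : Epi (epiPart p ≫ imIncl p) := by rw [epiPart_comp]; infer_instance
      have : Epi (imIncl p) := epi_of_epi (epiPart p) (imIncl p)
      have h1 : r ≫ imIncl p = 𝟙 d := by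
        rw [← cancel_epi (imIncl p), reassoc_of% hr, Category.comp_id]
      calc (r ≫ s) ≫ p = r ≫ (s ≫ epiPart p) ≫ imIncl p := by
            rw [Category.assoc, Category.assoc, epiPart_comp]
        _ = 𝟙 d := by rw [hs, Category.id_comp, h1]
    -- `m : d ⟶ c` is a section of `γ(c) p`; its image is the object we look for
    let m : d ⟶ c := s ≫ inv (γ.app c)
    have hm : m ≫ γ.app c ≫ p = 𝟙 d := by simp [m, hs]
    obtain ⟨t, ht⟩ := epiPart_split m
    have e1 : epiPart m ≫ imIncl m ≫ γ.app c ≫ p = 𝟙 d := by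
      rw [← Category.assoc, epiPart_comp, hm]
    have e2 : (imIncl m ≫ γ.app c ≫ p) ≫ epiPart m = 𝟙 _ := by
      rw [← cancel_epi (epiPart m)]
      rw [← Category.assoc, e1, Category.id_comp, Category.comp_id]
    refine ⟨im m, ?_⟩
    rw [← γ.incl_comp _ (imIncl_incl m), Category.assoc]
    exact ⟨⟨epiPart m, e2, e1⟩⟩

/-- The map `f ↦ γ * f°` on `C(c_γ, c)`. -/
def NormalCone.starEpi (γ : NormalCone C) (c : C) (f : γ.apex ⟶ c) : NormalCone C :=
  γ.star (epiPart f)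

theorem NormalCone.starEpi_injective (γ : NormalCone C) (c : C) :
    Function.Injective (γ.starEpi c) := by
  intro f g h
  obtain ⟨a, ha⟩ := γ.exists_iso
  have key : ∀ (x y : C) (p : γ.apex ⟶ x) (p' : γ.apex ⟶ y) (j : x ⟶ c) (j' : y ⟶ c)
      [Epi p] [Epi p'], IsIncl j → IsIncl j' → γ.star p = γ.star p' → p ≫ j = p' ≫ j' := by
    intro x y p p' j j' _ _ hj hj' e
    obtain rfl : x = y := congrArg NormalCone.apex e
    obtain rfl := IsCatWithSubobjects.unique _ _ hj hj'
    have e2 : (γ.star p).app = (γ.star p').app := by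
      simpa [NormalCone.ext_iff, star] using e
    have e3 : γ.app a ≫ p = γ.app a ≫ p' := congrFun e2 a
    rw [(cancel_epi (γ.app a)).1 e3]
  have := key _ _ _ _ _ _ (imIncl_incl f) (imIncl_incl g) h
  rwa [epiPart_comp, epiPart_comp] at this

end Normal

/-! ### H-functors and the normal dual -/

variable (C) in
/-- A functor from `C` to sets all of whose values are sets of normal cones in `C`.  The values
are kept as sets, not just as types, so that equality and inclusion of such functors are those
of set-valued functors. -/
structure ConeFunctor where
  obj : C → Set (NormalCone C)
  map : ∀ {c d : C}, (c ⟶ d) → obj c → obj d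
  map_id : ∀ (c : C) (x : obj c), map (𝟙 c) x = x
  map_comp : ∀ {a b c : C} (f : a ⟶ b) (g : b ⟶ c) (x : obj a),
    map (f ≫ g) x = map g (map f x)

/-- The underlying functor to the category of types. -/
def ConeFunctor.toFunctor (F : ConeFunctor C) : C ⥤ Type u where
  obj c := F.obj c
  map g := ↾(F.map g)
  map_id c := ConcreteCategory.hom_ext _ _ fun x => F.map_id c x
  map_comp f g := ConcreteCategory.hom_ext _ _ fun x => F.map_comp f g x

section Normal

variable [IsNormalCategory C]

/-- The bijection `f ↦ γ * f°` from `C(c_γ, c)` onto `{γ * f° | f ∈ C(c_γ, c)}`. -/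
def NormalCone.starEquiv (γ : NormalCone C) (c : C) :
    (γ.apex ⟶ c) ≃ Set.range (γ.starEpi c) :=
  Equiv.ofInjective _ (γ.starEpi_injective c)

/-- The H-functor `H(γ; -)`: it sends `c` to `{γ * f° | f ∈ C(c_γ, c)}` and `g` to the map
`γ * f° ↦ γ * (f g)°`. -/
def NormalCone.H (γ : NormalCone C) : ConeFunctor C where
  obj c := Set.range (γ.starEpi c)
  map {c d} g x := γ.starEquiv d ((γ.starEquiv c).symm x ≫ g)
  map_id c x := by simp
  map_comp f g x := by simp

/-- The natural isomorphism `η_γ : H(γ; -) ≅ C(c_γ, -)`, `γ * f° ↦ f`. -/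
def NormalCone.η (γ : NormalCone C) :
    γ.H.toFunctor ≅ coyoneda.obj (Opposite.op γ.apex) :=
  NatIso.ofComponents (fun c => (γ.starEquiv c).symm.toIso) fun {c d} g =>
    ConcreteCategory.hom_ext _ _ fun x =>
      (γ.starEquiv d).symm_apply_apply ((γ.starEquiv c).symm x ≫ g)

variable (C) in
/-- The objects of the normal dual `N*C`: the H-functors. -/
structure NormalDual where
  fn : ConeFunctor C
  isH : ∃ γ : NormalCone C, fn = γ.H

/-- The morphisms of `N*C` are all natural transformations between H-functors. -/
@[ext]
structure NormalDual.Hom (F G : NormalDual C) where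
  nat : F.fn.toFunctor ⟶ G.fn.toFunctor

/-- The normal dual, a full subcategory of the category of functors from `C` to sets. -/
instance : SmallCategory (NormalDual C) where
  Hom F G := NormalDual.Hom F G
  id F := ⟨𝟙 _⟩
  comp σ τ := ⟨σ.nat ≫ τ.nat⟩

/-- The map of sets of normal cones given by a component of a morphism of `N*C`. -/
def NormalDual.comp {F G : NormalDual C} (σ : F ⟶ G) (c : C) : F.fn.obj c → G.fn.obj c :=
  fun x => (NormalDual.Hom.nat σ).app c x

/-- The inclusions of `N*C` are the inclusions of functors: all components are
inclusions of sets. -/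
instance : HasInclusions (NormalDual C) where
  incl _ _ σ := ∀ c x, (NormalDual.comp σ c x).1 = x.1

/-- `H(γ; -)` as an object of `N*C`. -/
abbrev NormalCone.HObj (γ : NormalCone C) : NormalDual C := ⟨γ.H, γ, rfl⟩

/-- The `M`-set of an H-functor `H(γ; -)` is that of `γ`. -/
def NormalDual.M (F : NormalDual C) : Set C :=
  {c | ∃ γ : NormalCone C, F.fn = γ.H ∧ c ∈ γ.M}

end Normal

/-! ### Local isomorphisms and cross-connections -/

/-- The objects of the ideal `⟨c⟩`, a full subcategory. -/
def ideal (c : C) : ObjectProperty C := fun d => Sub d c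

/-- An isomorphism of categories: a functor bijective on objects and fully faithful. -/
structure IsCatIso {A B : Type u} [SmallCategory A] [SmallCategory B] (F : A ⥤ B) : Prop where
  bij : Function.Bijective F.obj
  full : F.Full
  faithful : F.Faithful

variable {D : Type u} [SmallCategory D] [HasInclusions D]

/-- The restriction of an inclusion preserving functor to a functor `⟨c⟩ ⥤ ⟨F c⟩`. -/
def restrictIdeal (F : C ⥤ D) (hF : ∀ {a b : C} (j : a ⟶ b), IsIncl j → IsIncl (F.map j))
    (c : C) : (ideal c).FullSubcategory ⥤ (ideal (F.obj c)).FullSubcategory :=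
  (ideal (F.obj c)).lift ((ideal c).ι ⋙ F) fun X => by
    obtain ⟨j, hj⟩ := X.property
    exact ⟨F.map j, hF j hj⟩

/-- Local isomorphisms between normal categories. -/
structure IsLocalIso (F : C ⥤ D) : Prop where
  normal_source : IsNormalCategory C
  normal_target : IsNormalCategory D
  map_incl : ∀ {a b : C} (j : a ⟶ b), IsIncl j → IsIncl (F.map j)
  full : F.Full
  faithful : F.Faithful
  iso_ideal : ∀ c : C, IsCatIso (restrictIdeal F map_incl c)

/-- `(D, C; Γ)` is a cross-connection from `D` to `C`. -/
structure IsCrossConnection [IsNormalCategory C] (Γ : D ⥤ NormalDual C) : Prop where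
  normal_source : IsNormalCategory D
  localIso : IsLocalIso Γ
  exists_mem_M : ∀ c : C, ∃ d : D, c ∈ (Γ.obj d).M

end General

/-! ### Regular semigroups and the groupoid of a regular semigroup -/

/-- Regular semigroups: every element has an inverse. -/
class IsRegularSemigroup (S : Type u) [Semigroup S] : Prop where
  exists_inverse : ∀ a : S, ∃ b : S, a * b * a = a ∧ b * a * b = b

instance (S : Type u) [Semigroup S] [IsRegularSemigroup S] : IsRegularSemigroup Sᵐᵒᵖ where
  exists_inverse a := by
    obtain ⟨b, h1, h2⟩ := IsRegularSemigroup.exists_inverse a.unop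
    exact ⟨MulOpposite.op b, MulOpposite.unop_injective (by simp [← mul_assoc, h1]),
      MulOpposite.unop_injective (by simp [← mul_assoc, h2])⟩

/-- The set `E(S)` of idempotents. -/
abbrev E (S : Type u) [Semigroup S] : Type u := {e : S // IsIdempotentElem e}

section LG

variable {S : Type u} [Semigroup S]

/-- The quasi-order `ω^l`: `e f = e`. -/
def omegaL (e f : E S) : Prop := e.1 * f.1 = e.1

/-- The quasi-order `ω^r`: `f e = e`. -/
def omegaR (e f : E S) : Prop := f.1 * e.1 = e.1

variable (S) in
/-- The relation `ℒ = ω^l ∩ (ω^l)⁻¹` on `E(S)`. -/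
def setoidL : Setoid (E S) where
  r e f := omegaL e f ∧ omegaL f e
  iseqv :=
    { refl := fun e => ⟨e.2, e.2⟩
      symm := fun h => ⟨h.2, h.1⟩
      trans := by
        rintro e f g ⟨h1, h2⟩ ⟨h3, h4⟩
        simp only [omegaL] at *
        exact ⟨by rw [← h1, mul_assoc, h3], by rw [← h4, mul_assoc, h2]⟩ }

/-- A morphism `(x, x')` of `𝒢(S)` from `e` to `f`: `x'` is an inverse of `x`, `x x' = e` and
`x' x = f`. -/
@[ext]
structure GHom (e f : E S) where
  x : S
  x' : S
  inv_left : x * x' * x = x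
  inv_right : x' * x * x' = x'
  dom : x * x' = e.1
  cod : x' * x = f.1

variable (S) in
/-- The objects of `𝒢(S)`. -/
def GObj : Type u := E S

/-- The groupoid `𝒢(S)`, with `(x, x') (y, y') = (x y, y' x')` and `(x, x')⁻¹ = (x', x)`. -/
instance : Groupoid.{u} (GObj S) where
  Hom e f := GHom (S := S) e f
  id e := ⟨e.1, e.1, by rw [e.2, e.2], by rw [e.2, e.2], e.2, e.2⟩
  comp {e f g} p q :=
    have h1 : p.x * q.x * (q.x' * p.x') = e.1 := by
      rw [← p.dom, mul_assoc, ← mul_assoc q.x, q.dom, ← p.cod, ← mul_assoc, ← mul_assoc,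
        p.inv_left]
    have h2 : q.x' * p.x' * (p.x * q.x) = g.1 := by
      rw [← q.cod, mul_assoc, ← mul_assoc p.x', p.cod, ← q.dom, ← mul_assoc, ← mul_assoc,
        q.inv_right]
    ⟨p.x * q.x, q.x' * p.x', by rw [h1, ← p.dom, ← mul_assoc, p.inv_left],
      by rw [h2, ← q.cod, ← mul_assoc, q.inv_right], h1, h2⟩
  id_comp {e f} p := by
    ext
    · change e.1 * p.x = p.x; rw [← p.dom, p.inv_left]
    · change p.x' * e.1 = p.x'; rw [← p.dom, ← mul_assoc, p.inv_right]
  comp_id {e f} p := by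
    ext
    · change p.x * f.1 = p.x; rw [← p.cod, ← mul_assoc, p.inv_left]
    · change f.1 * p.x' = p.x'; rw [← p.cod, p.inv_right]
  assoc p q r := by
    ext
    · exact mul_assoc _ _ _
    · exact (mul_assoc _ _ _).symm
  inv p := ⟨p.x', p.x, p.inv_right, p.inv_left, p.cod, p.dom⟩
  inv_comp {e f} p := by
    ext
    · exact p.cod
    · exact p.cod
  comp_inv {e f} p := by
    ext
    · exact p.dom
    · exact p.dom

/-! ### The quiver `ℒ_Q` and the category `ℒ_G` -/

/-- `(e, u, f)` is a morphism `j(e, f) = j(e, e, f)` of `𝒫_L`, where `e ω^l f`. -/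
def InPL (e : E S) (u : S) (f : E S) : Prop := omegaL e f ∧ u = e.1

/-- `(e, u, f)` is a morphism `q(e, u, f)` of `𝒬_L`, where `u` is an idempotent,
`u ℒ f` and `u ω e`. -/
def InQL (e : E S) (u : S) (f : E S) : Prop :=
  ∃ h : E S, u = h.1 ∧ (setoidL S).r h f ∧ omegaL h e ∧ omegaR h e

/-- `(e, u, f)` is a morphism `g(e, x, f)` of `𝒢_L`, coming from a morphism `(x, x')` of
`𝒢(S)` from `e` to `f`. -/
def InGL (e : E S) (u : S) (f : E S) : Prop :=
  ∃ p : @Quiver.Hom (GObj S) _ e f, u = GHom.x p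

variable (S) in
/-- The vertices of the quiver `ℒ_Q`: the set `E/ℒ`. -/
def LQ : Type u := Quotient (setoidL S)

/-- The `ℒ`-class of an idempotent. -/
def LQ.mk (e : E S) : LQ S := Quotient.mk (setoidL S) e

/-- An arrow `r(e, u, f)` of `ℒ_Q = 𝒫_L ∪ 𝒬_L ∪ 𝒢_L` from the class of `e` to that of `f`. -/
structure LArrow (a b : LQ S) where
  src : E S
  val : S
  tgt : E S
  src_eq : LQ.mk src = a
  tgt_eq : LQ.mk tgt = b
  mem : InPL src val tgt ∨ InQL src val tgt ∨ InGL src val tgt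

instance : Quiver.{u} (LQ S) where
  Hom a b := LArrow a b

/-- A path of arrows `r(e₁, u₁, f₁) ⋯ r(eₙ, uₙ, fₙ)` starting at the class of `e`
composes to `r(e, e u₁ ⋯ uₙ, fₙ)`; this is its middle entry, which is `u₁ ⋯ uₙ` if `e = e₁`.
The empty path at the class of `e` is `r(e, e, e)`. -/
def pathVal (e : E S) {a : LQ S} : ∀ {b : LQ S}, Quiver.Path a b → S
  | _, .nil => e.1
  | _, .cons p r => pathVal e p * LArrow.val r

theorem LArrow.src_mul {a b : LQ S} (r : LArrow a b) : r.src.1 * r.val = r.val := by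
  rcases r.mem with ⟨_, h⟩ | ⟨h, e, _, _, h2⟩ | ⟨p, h⟩
  · rw [h]; exact r.src.2
  · rw [e]; exact h2
  · rw [h, ← GHom.dom p]; exact p.inv_left

theorem LArrow.mul_tgt {a b : LQ S} (r : LArrow a b) : r.val * r.tgt.1 = r.val := by
  rcases r.mem with ⟨h1, h⟩ | ⟨h, e, h1, _, _⟩ | ⟨p, h⟩
  · rw [h]; exact h1
  · rw [e]; exact h1.1
  · rw [h, ← GHom.cod p, ← mul_assoc]; exact p.inv_left

theorem LQ.mk_eq {e f : E S} : LQ.mk e = LQ.mk f ↔ e.1 * f.1 = e.1 ∧ f.1 * e.1 = f.1 :=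
  Quotient.eq (r := setoidL S)

theorem pathVal_mul {a b : LQ S} (p : Quiver.Path a b) (e f : E S) (he : LQ.mk e = a)
    (hf : LQ.mk f = b) : pathVal e p * f.1 = pathVal e p := by
  cases p with
  | nil => exact (LQ.mk_eq.1 (he.trans hf.symm)).1
  | cons p r =>
    have h := (LQ.mk_eq.1 ((LArrow.tgt_eq r).trans hf.symm)).1
    simp only [pathVal]
    rw [mul_assoc, ← LArrow.mul_tgt r, mul_assoc, h]

theorem pathVal_change {a b : LQ S} (p : Quiver.Path a b) (e g : E S) (he : LQ.mk e = a)
    (hg : LQ.mk g = a) : e.1 * pathVal g p = pathVal e p := by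
  induction p with
  | nil => exact (LQ.mk_eq.1 (he.trans hg.symm)).1
  | cons p r ih => simp only [pathVal]; rw [← mul_assoc, ih]

theorem pathVal_comp {a b c : LQ S} (p : Quiver.Path a b) (q : Quiver.Path b c) (e f : E S)
    (he : LQ.mk e = a) (hf : LQ.mk f = b) :
    pathVal e (p.comp q) = pathVal e p * pathVal f q := by
  induction q with
  | nil => exact (pathVal_mul p e f he hf).symm
  | cons q r ih => simp only [pathVal, Quiver.Path.comp_cons]; rw [ih, mul_assoc]

/-- The relation `∼` on the morphisms of the free category on `ℒ_Q`:
`r(e, u, f) ∼ r(g, v, h)` iff `e ℒ g`, `f ℒ h` and `u = e v`.  For two paths with the same end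
points the conditions `e ℒ g` and `f ℒ h` hold automatically. -/
def pathSetoid (a b : LQ S) : Setoid (Quiver.Path a b) where
  r p q := ∀ e g : E S, LQ.mk e = a → LQ.mk g = a → pathVal e p = e.1 * pathVal g q
  iseqv :=
    { refl := fun p e g he hg => (pathVal_change p e g he hg).symm
      symm := fun {p q} h e g he hg => by
        rw [pathVal_change p e g he hg, h e e he he, pathVal_change q e e he he]
      trans := fun {p q r} h1 h2 e g he hg => by
        rw [h1 e e he he, pathVal_change q e e he he, h2 e g he hg] }

theorem pathSetoid_iff {a b : LQ S} {p q : Quiver.Path a b} :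
    (pathSetoid a b).r p q ↔ ∀ e : E S, LQ.mk e = a → pathVal e p = pathVal e q := by
  constructor
  · intro h e he
    rw [h e e he he, pathVal_change q e e he he]
  · intro h e g he hg
    rw [h e he, pathVal_change q e g he hg]

variable (S) in
/-- The objects of `ℒ_G`: the set `E/ℒ`. -/
structure LG : Type u where
  cls : LQ S

/-- The object of `ℒ_G` given by the `ℒ`-class of `e`. -/
def LG.mk' (e : E S) : LG S := ⟨LQ.mk e⟩

theorem LQ.exists_rep (a : LQ S) : ∃ e : E S, LQ.mk e = a := Quotient.exists_rep a

/-- The category `ℒ_G`: the quotient of the free category on the quiver `ℒ_Q` by `∼`. -/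
instance : SmallCategory (LG S) where
  Hom a b := Quotient (pathSetoid a.cls b.cls)
  id a := Quotient.mk _ Quiver.Path.nil
  comp {a b c} p q := Quotient.map₂ (fun p q => Quiver.Path.comp p q) (by
    intro p p' hp q q' hq
    obtain ⟨f, hf⟩ := LQ.exists_rep b.cls
    refine pathSetoid_iff.2 fun e he => ?_
    rw [pathVal_comp p q e f he hf, pathVal_comp p' q' e f he hf, pathSetoid_iff.1 hp e he,
      pathSetoid_iff.1 hq f hf]) p q
  id_comp p := by
    refine Quotient.inductionOn p fun p => ?_
    exact congrArg (Quotient.mk _) (Quiver.Path.nil_comp p)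
  comp_id p := by
    refine Quotient.inductionOn p fun p => ?_
    exact congrArg (Quotient.mk _) (Quiver.Path.comp_nil p)
  assoc p q r := by
    refine Quotient.inductionOn₃ p q r fun p q r => ?_
    exact congrArg (Quotient.mk _) (Quiver.Path.comp_assoc p q r)

/-- The morphism of `ℒ_G` given by an arrow of the quiver `ℒ_Q`. -/
def LG.ofArrow {a b : LG S} (r : LArrow a.cls b.cls) : a ⟶ b :=
  Quotient.mk (pathSetoid a.cls b.cls) (Quiver.Hom.toPath (V := LQ S) r)

/-- The middle entry `u` of a morphism `r(e, u, f)` of `ℒ_G`, for a representative `e` of its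
domain. -/
def LG.val {a b : LG S} (e : E S) (he : LG.mk' e = a) (m : a ⟶ b) : S :=
  Quotient.lift (s := pathSetoid a.cls b.cls) (fun p => pathVal e p)
    (fun _ _ h => pathSetoid_iff.1 h e (congrArg LG.cls he)) m

theorem LG.hom_ext {a b : LG S} (e : E S) (he : LG.mk' e = a) {m n : a ⟶ b}
    (h : LG.val e he m = LG.val e he n) : m = n := by
  revert h
  refine Quotient.inductionOn₂ m n fun p q h => Quotient.sound (pathSetoid_iff.2 fun g hg => ?_)
  change pathVal e p = pathVal e q at h
  have he' : LQ.mk e = a.cls := congrArg LG.cls he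
  rw [← pathVal_change p g e hg he', h, pathVal_change q g e hg he']

theorem LG.val_id {a : LG S} (e : E S) (he : LG.mk' e = a) : LG.val e he (𝟙 a) = e.1 := rfl

theorem LG.val_comp {a b c : LG S} (e f : E S) (he : LG.mk' e = a) (hf : LG.mk' f = b)
    (m : a ⟶ b) (n : b ⟶ c) : LG.val e he (m ≫ n) = LG.val e he m * LG.val f hf n :=
  Quotient.inductionOn₂ m n fun p q =>
    pathVal_comp p q e f (congrArg LG.cls he) (congrArg LG.cls hf)

theorem LG.val_mul {a b : LG S} (e f : E S) (he : LG.mk' e = a) (hf : LG.mk' f = b)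
    (m : a ⟶ b) : LG.val e he m * f.1 = LG.val e he m :=
  Quotient.inductionOn m fun p => pathVal_mul p e f (congrArg LG.cls he) (congrArg LG.cls hf)

theorem LG.val_change {a b : LG S} (e g : E S) (he : LG.mk' e = a) (hg : LG.mk' g = a)
    (m : a ⟶ b) : e.1 * LG.val g hg m = LG.val e he m :=
  Quotient.inductionOn m fun p =>
    pathVal_change p e g (congrArg LG.cls he) (congrArg LG.cls hg)

theorem LG.mul_val {a b : LG S} (e : E S) (he : LG.mk' e = a) (m : a ⟶ b) :
    e.1 * LG.val e he m = LG.val e he m := LG.val_change e e he he m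

theorem LG.val_ofArrow {a b : LG S} (e : E S) (he : LG.mk' e = a) (r : LArrow a.cls b.cls) :
    LG.val e he (LG.ofArrow r) = e.1 * r.val := rfl

theorem LG.exists_rep (a : LG S) : ∃ e : E S, LG.mk' e = a := by
  obtain ⟨e, he⟩ := LQ.exists_rep a.cls
  exact ⟨e, by cases a; exact congrArg LG.mk he⟩

theorem LG.mk'_eq {e f : E S} :
    LG.mk' e = LG.mk' f ↔ e.1 * f.1 = e.1 ∧ f.1 * e.1 = f.1 := by
  rw [← LQ.mk_eq]
  exact ⟨fun h => congrArg LG.cls h, fun h => congrArg LG.mk h⟩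

/-- The inclusions of `ℒ_G` are the morphisms `j(e, f) = r(e, e, f)` of `𝒫_L`. -/
instance : HasInclusions (LG S) where
  incl a b m := ∃ r : LArrow a.cls b.cls, InPL r.src r.val r.tgt ∧ m = LG.ofArrow r

/-- `u ∈ e S f`. -/
def InESF (e : E S) (u : S) (f : E S) : Prop := ∃ s : S, u = e.1 * s * f.1

theorem InESF.left {e f : E S} {u : S} (h : InESF e u f) : e.1 * u = u := by
  obtain ⟨s, rfl⟩ := h
  rw [← mul_assoc, ← mul_assoc, e.2]

theorem InESF.right {e f : E S} {u : S} (h : InESF e u f) : u * f.1 = u := by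
  obtain ⟨s, rfl⟩ := h
  rw [mul_assoc, f.2]

theorem InESF.of {e f : E S} {u : S} (h : e.1 * u = u) (h' : u * f.1 = u) : InESF e u f :=
  ⟨u, by rw [h, h']⟩

theorem exists_inverse_below [IsRegularSemigroup S] {e f : E S} {u : S} (hu : InESF e u f) :
    ∃ v : S, u * v * u = u ∧ v * u * v = v ∧ v * e.1 = v := by
  obtain ⟨w, h1, h2⟩ := IsRegularSemigroup.exists_inverse u
  refine ⟨w * e.1, ?_, ?_, ?_⟩
  · rw [mul_assoc, mul_assoc, hu.left, ← mul_assoc, h1]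
  · rw [mul_assoc w, hu.left, ← mul_assoc, h2]
  · rw [mul_assoc, e.2]

/-- For `u ∈ e S f`, an inverse `v` of `u` with `v e = v`; then
`g = u v` is an idempotent in `R_u ∩ ω(e)` and `h = v u` is an idempotent in `L_u`. -/
def invBelow [IsRegularSemigroup S] {e f : E S} {u : S} (hu : InESF e u f) : S :=
  (exists_inverse_below hu).choose

theorem invBelow_spec [IsRegularSemigroup S] {e f : E S} {u : S} (hu : InESF e u f) :
    u * invBelow hu * u = u ∧ invBelow hu * u * invBelow hu = invBelow hu ∧
      invBelow hu * e.1 = invBelow hu :=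
  (exists_inverse_below hu).choose_spec

/-- The idempotent `g ∈ E(R_u) ∩ ω(e)`. -/
def gOf [IsRegularSemigroup S] {e f : E S} {u : S} (hu : InESF e u f) : E S :=
  ⟨u * invBelow hu, by
    change u * invBelow hu * (u * invBelow hu) = _
    rw [← mul_assoc, (invBelow_spec hu).1]⟩

/-- The idempotent `h ∈ E(L_u)`. -/
def hOf [IsRegularSemigroup S] {e f : E S} {u : S} (hu : InESF e u f) : E S :=
  ⟨invBelow hu * u, by
    change invBelow hu * u * (invBelow hu * u) = _
    rw [← mul_assoc, (invBelow_spec hu).2.1]⟩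

/-- The retraction `r(e, g, g)`. -/
def arrowQ [IsRegularSemigroup S] {a : LG S} {e f : E S} {u : S} (he : LG.mk' e = a)
    (hu : InESF e u f) : LArrow a.cls (LG.mk' (gOf hu)).cls where
  src := e
  val := (gOf hu).1
  tgt := gOf hu
  src_eq := congrArg LG.cls he
  tgt_eq := rfl
  mem := Or.inr <| Or.inl ⟨gOf hu, rfl, (setoidL S).refl _,
    by change u * invBelow hu * e.1 = u * invBelow hu; rw [mul_assoc, (invBelow_spec hu).2.2],
    by change e.1 * (u * invBelow hu) = u * invBelow hu; rw [← mul_assoc, hu.left]⟩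

/-- The isomorphism `r(g, u, h)`. -/
def arrowG [IsRegularSemigroup S] {e f : E S} {u : S} (hu : InESF e u f) :
    LArrow (LG.mk' (gOf hu)).cls (LG.mk' (hOf hu)).cls where
  src := gOf hu
  val := u
  tgt := hOf hu
  src_eq := rfl
  tgt_eq := rfl
  mem := Or.inr <| Or.inr
    ⟨⟨u, invBelow hu, (invBelow_spec hu).1, (invBelow_spec hu).2.1, rfl, rfl⟩, rfl⟩

/-- The inclusion `r(h, h, f)`. -/
def arrowP [IsRegularSemigroup S] {b : LG S} {e f : E S} {u : S} (hf : LG.mk' f = b)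
    (hu : InESF e u f) : LArrow (LG.mk' (hOf hu)).cls b.cls where
  src := hOf hu
  val := (hOf hu).1
  tgt := f
  src_eq := rfl
  tgt_eq := congrArg LG.cls hf
  mem := Or.inl ⟨by
    change invBelow hu * u * f.1 = invBelow hu * u
    rw [mul_assoc, hu.right], rfl⟩

/-- The morphism `r(e, u, f) = r(e, g, g) r(g, u, h) r(h, h, f)` of `ℒ_G`, for `u ∈ e S f`, from
the class `a` of `e` to the class `b` of `f`. -/
def LG.r [IsRegularSemigroup S] {a b : LG S} (e : E S) (u : S) (f : E S) (he : LG.mk' e = a)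
    (hf : LG.mk' f = b) (hu : InESF e u f) : a ⟶ b :=
  LG.ofArrow (arrowQ he hu) ≫ LG.ofArrow (arrowG hu) ≫ LG.ofArrow (arrowP hf hu)

theorem LG.val_r [IsRegularSemigroup S] {a b : LG S} (e : E S) (u : S) (f : E S) (he : LG.mk' e = a)
    (hf : LG.mk' f = b) (hu : InESF e u f) (g : E S) (hg : LG.mk' g = a) :
    LG.val g hg (LG.r e u f he hf hu) = g.1 * u := by
  obtain ⟨h1, h2, h3⟩ := invBelow_spec hu
  rw [LG.r, LG.val_comp g (gOf hu) hg rfl, LG.val_comp (gOf hu) (hOf hu) rfl rfl,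
    LG.val_ofArrow, LG.val_ofArrow, LG.val_ofArrow]
  change g.1 * (u * invBelow hu) * (u * invBelow hu * u * (invBelow hu * u * (invBelow hu * u)))
    = g.1 * u
  rw [h1, ← mul_assoc (invBelow hu * u), h2, ← mul_assoc u, h1, mul_assoc, h1]

theorem LG.isIncl_iff {a b : LG S} (m : a ⟶ b) :
    IsIncl m ↔ ∀ e he, LG.val e he m = e.1 := by
  constructor
  · rintro ⟨r, ⟨_, h2⟩, rfl⟩ e he
    rw [LG.val_ofArrow, h2]
    exact (LQ.mk_eq.1 ((congrArg LG.cls he).trans r.src_eq.symm)).1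
  · intro h
    obtain ⟨e, he⟩ := LG.exists_rep a
    obtain ⟨f, hf⟩ := LG.exists_rep b
    have hp : InPL e e.1 f := ⟨by
      have := LG.val_mul e f he hf m
      rwa [h e he] at this, rfl⟩
    refine ⟨⟨e, e.1, f, congrArg LG.cls he, congrArg LG.cls hf, Or.inl hp⟩, hp, ?_⟩
    apply LG.hom_ext e he
    rw [h e he, LG.val_ofArrow]
    exact e.2.symm

instance : IsCatWithSubobjects (LG S) where
  id_mem c := (LG.isIncl_iff _).2 fun e he => LG.val_id e he
  comp_mem {a b c} m n hm hn := (LG.isIncl_iff _).2 fun e he => by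
    obtain ⟨f, hf⟩ := LG.exists_rep b
    rw [LG.val_comp e f he hf, (LG.isIncl_iff n).1 hn, LG.val_mul e f he hf,
      (LG.isIncl_iff m).1 hm]
  unique {a b} m n hm hn := by
    obtain ⟨e, he⟩ := LG.exists_rep a
    exact LG.hom_ext e he (by rw [(LG.isIncl_iff m).1 hm, (LG.isIncl_iff n).1 hn])
  strict {a b} m n hm hn := by
    obtain ⟨e, rfl⟩ := LG.exists_rep a
    obtain ⟨f, rfl⟩ := LG.exists_rep b
    have h1 := LG.val_mul e f rfl rfl m
    have h2 := LG.val_mul f e rfl rfl n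
    rw [(LG.isIncl_iff m).1 hm] at h1
    rw [(LG.isIncl_iff n).1 hn] at h2
    exact LG.mk'_eq.2 ⟨h1, h2⟩
  mono {a b} m hm := ⟨fun {c} h k hk => by
    obtain ⟨g, hg⟩ := LG.exists_rep c
    obtain ⟨e, he⟩ := LG.exists_rep a
    apply LG.hom_ext g hg
    have := congrArg (LG.val g hg) hk
    rwa [LG.val_comp g e hg he, LG.val_comp g e hg he, (LG.isIncl_iff m).1 hm,
      LG.val_mul g e hg he, LG.val_mul g e hg he] at this⟩
  of_comp {a b c} h g hhg hg := (LG.isIncl_iff _).2 fun e he => by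
    obtain ⟨f, hf⟩ := LG.exists_rep b
    have := (LG.isIncl_iff _).1 hhg e he
    rwa [LG.val_comp e f he hf, (LG.isIncl_iff g).1 hg, LG.val_mul e f he hf] at this

theorem inESF_mul_right (g e : E S) : InESF g (g.1 * e.1) e :=
  InESF.of (by rw [← mul_assoc, g.2]) (by rw [mul_assoc, e.2])

/-- A representative of an object of `ℒ_G`. -/
def LG.rep (c : LG S) : E S := (LG.exists_rep c).choose

theorem LG.rep_spec (c : LG S) : LG.mk' c.rep = c := (LG.exists_rep c).choose_spec

variable [IsRegularSemigroup S]

theorem LG.val_rCone (e : E S) (c : LG S) (g : E S) (hg : LG.mk' g = c) :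
    LG.val g hg (LG.r c.rep (c.rep.1 * e.1) e c.rep_spec rfl (inESF_mul_right c.rep e)) =
      g.1 * e.1 := by
  rw [LG.val_r, ← mul_assoc, (LG.mk'_eq.1 (hg.trans c.rep_spec.symm)).1]

/-- The principal cone `r^e`, with apex the class of `e` and components `r(g, g e, e)`; they do not
depend on the representative `g`, see `rCone_app`. -/
abbrev rCone (e : E S) : NormalCone (LG S) where
  apex := LG.mk' e
  app c := LG.r c.rep (c.rep.1 * e.1) e c.rep_spec rfl (inESF_mul_right c.rep e)
  incl_comp {c c'} j hj := by
    obtain ⟨g, hg⟩ := LG.exists_rep c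
    obtain ⟨g', hg'⟩ := LG.exists_rep c'
    apply LG.hom_ext g hg
    rw [LG.val_comp g g' hg hg', LG.val_rCone, LG.val_rCone, ← mul_assoc,
      LG.val_mul g g' hg hg', (LG.isIncl_iff j).1 hj]
  exists_iso := by
    refine ⟨LG.mk' e, ?_⟩
    have : LG.r (LG.mk' e).rep ((LG.mk' e).rep.1 * e.1) e (LG.mk' e).rep_spec rfl
        (inESF_mul_right _ e) = 𝟙 (LG.mk' e) := by
      apply LG.hom_ext e rfl
      rw [LG.val_rCone, LG.val_id]
      exact e.2
    rw [this]
    infer_instance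

theorem rCone_app (e g : E S) :
    (rCone e).app (LG.mk' g) = LG.r g (g.1 * e.1) e rfl rfl (inESF_mul_right g e) := by
  apply LG.hom_ext g rfl
  refine (LG.val_rCone e _ g rfl).trans ((LG.val_r _ _ _ _ _ _ _ _).trans ?_).symm
  rw [← mul_assoc, g.2]

instance : IsNormalCategory (LG S) where
  factorization {a b} m := by
    obtain ⟨e, he⟩ := LG.exists_rep a
    obtain ⟨f, hf⟩ := LG.exists_rep b
    have hu : InESF e (LG.val e he m) f := InESF.of (LG.mul_val e he m) (LG.val_mul e f he hf m)
    obtain ⟨h1, h2, h3⟩ := invBelow_spec hu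
    have hgu : InESF (hOf hu) (invBelow hu) (gOf hu) :=
      InESF.of h2 (by change invBelow hu * (_ * invBelow hu) = _; rw [← mul_assoc, h2])
    have hge : InESF (gOf hu) (gOf hu).1 e :=
      InESF.of (gOf hu).2 (by change _ * invBelow hu * e.1 = _ * invBelow hu; rw [mul_assoc, h3])
    refine ⟨⟨_, _, LG.ofArrow (arrowQ he hu), LG.ofArrow (arrowG hu),
      LG.ofArrow (arrowP hf hu), ?_, ?_, ?_, ?_⟩⟩
    · refine ⟨LG.r (gOf hu) (gOf hu).1 e rfl he hge, (LG.isIncl_iff _).2 fun g hg => ?_, ?_⟩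
      · rw [LG.val_r]
        exact (LG.mk'_eq.1 hg).1
      · apply LG.hom_ext (gOf hu) rfl
        rw [LG.val_comp (gOf hu) e rfl he, LG.val_r, LG.val_ofArrow, LG.val_id, (gOf hu).2,
          ← mul_assoc, hge.right]
        exact (gOf hu).2
    · refine ⟨⟨LG.r (hOf hu) (invBelow hu) (gOf hu) rfl rfl hgu, ?_, ?_⟩⟩
      · apply LG.hom_ext (gOf hu) rfl
        rw [LG.val_comp (gOf hu) (hOf hu) rfl rfl, LG.val_r, LG.val_ofArrow, LG.val_id, hgu.left]
        exact congrArg (· * invBelow hu) h1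
      · apply LG.hom_ext (hOf hu) rfl
        rw [LG.val_comp (hOf hu) (gOf hu) rfl rfl, LG.val_r, LG.val_ofArrow, LG.val_id, hgu.left]
        exact congrArg (invBelow hu * ·) h1
    · exact ⟨_, (arrowP hf hu).mem.elim id (fun _ => ⟨by
        change invBelow hu * _ * f.1 = invBelow hu * _
        rw [mul_assoc, hu.right], rfl⟩), rfl⟩
    · apply LG.hom_ext e he
      have := LG.val_r e _ f he hf hu e he
      rw [LG.r] at this
      rw [this, LG.mul_val]
  splits {a b} j hj := by
    obtain ⟨e, he⟩ := LG.exists_rep a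
    obtain ⟨f, hf⟩ := LG.exists_rep b
    refine ⟨LG.r f (f.1 * e.1) e hf he (inESF_mul_right f e), LG.hom_ext e he ?_⟩
    have h1 := LG.val_mul e f he hf j
    rw [(LG.isIncl_iff j).1 hj] at h1
    rw [LG.val_comp e f he hf, LG.val_r, (LG.isIncl_iff j).1 hj, LG.val_id, ← mul_assoc f.1,
      f.2, ← mul_assoc, h1]
    exact e.2
  cone c := by
    obtain ⟨e, rfl⟩ := LG.exists_rep c
    exact ⟨rCone e, rfl, LG.hom_ext e rfl ((LG.val_rCone e _ e rfl).trans e.2)⟩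

end LG

/-! ### The category `ℛ_G` and the functor `Γ_G` -/

section RG

variable (S : Type u) [Semigroup S]

/-- The category `ℛ_G` is built dually, that is, it is the category `ℒ_G` of the opposite
semigroup: there `ω^l`, `ℒ`, `e S f`, a product `u v` and a morphism `(x, x')` become `ω^r`,
`ℛ`, `f S e`, the product `v u` and the morphism `(x', x)` of `S`. -/
abbrev RG : Type u := LG Sᵐᵒᵖ

variable {S}

/-- An idempotent of `S` as an idempotent of the opposite semigroup. -/
def opE (e : E S) : E Sᵐᵒᵖ := ⟨MulOpposite.op e.1, by
  change MulOpposite.op e.1 * MulOpposite.op e.1 = MulOpposite.op e.1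
  rw [← MulOpposite.op_mul, e.2]⟩

/-- The object of `ℛ_G` given by the `ℛ`-class of `e`. -/
abbrev RG.mk' (e : E S) : RG S := LG.mk' (opE e)

theorem InESF.op {e f : E S} {u : S} (hu : InESF f u e) :
    InESF (opE e) (MulOpposite.op u) (opE f) := by
  obtain ⟨s, rfl⟩ := hu
  exact ⟨MulOpposite.op s, by simp [opE, mul_assoc]⟩

variable [IsRegularSemigroup S]

/-- The morphism `l(e, u, f)` of `ℛ_G`, for `u ∈ f S e`, from the class of `e` to that of `f`. -/
def RG.l (e : E S) (u : S) (f : E S) (hu : InESF f u e) : RG.mk' e ⟶ RG.mk' f :=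
  LG.r (opE e) (MulOpposite.op u) (opE f) rfl rfl hu.op

/-- The natural transformation `η_{r^e} ℒ_G(r(f, u, e), -) η_{r^f}⁻¹` from `H(r^e; -)` to
`H(r^f; -)`, for `u ∈ f S e`. -/
def transported (e : E S) (u : S) (f : E S) (hu : InESF f u e) :
    (rCone e).HObj ⟶ (rCone f).HObj :=
  NormalDual.Hom.mk ((rCone e).η.hom ≫
    coyoneda.map (Quiver.Hom.op (LG.r (a := (rCone f).apex) (b := (rCone e).apex)
      f u e rfl rfl hu)) ≫ (rCone f).η.inv)

/-- The defining equations of the functor `Γ_G`. -/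
structure IsGammaG (Γ : RG S ⥤ NormalDual (LG S)) : Prop where
  obj_eq : ∀ e : E S, Γ.obj (RG.mk' e) = (rCone e).HObj
  map_eq : ∀ (e : E S) (u : S) (f : E S) (hu : InESF f u e),
    Γ.map (RG.l e u f hu) =
      eqToHom (obj_eq e) ≫ transported e u f hu ≫ eqToHom (obj_eq f).symm

end RG

end CrossConn

end

/-!
By Yoneda, the natural transformations `H(γ; -) ⟶ H(δ; -)` correspond contravariantly to the
morphisms `f : c_δ ⟶ c_γ`, and `f` gives an inclusion of functors exactly when `γ = δ * f`. Hence
factorizations and splittings in `N*C` come from those in `C`, and an idempotent cone `ε` yields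
the cone in `N*C` with apex `H(ε; -)` that sends `δ` to `ε * δ(c_ε)°`.

The correspondence `l(e, u, f) ↔ r(f, u, e)` makes `Γ_G` fully faithful. For `e ω^r f` one has
`r^e = r^f * r(f, e, e)`, so `Γ_G` preserves inclusions and `H(r^e; -)` depends only on the
`ℛ`-class of `e`. A fully faithful functor `F` that preserves inclusions is a local isomorphism as
soon as every subobject of `F c` is the image of a subobject of `c`. Let `H(γ; -) ⊆ H(r^f; -)` be
given by `r(f, u, h)`, which has a section `r(h, v, f)`. Then `e = u v` is an idempotent with
`e ω^r f`, and `γ = r^e * r(e, u, h)` where `r(e, u, h)` is an isomorphism, so that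
`H(γ; -) = H(r^e; -)`.
-/

noncomputable section

namespace CrossConn

section Subobjects

variable {C : Type u} [SmallCategory C] [HasInclusions C] [IsCatWithSubobjects C]

theorem sub_antisymm {a b : C} (hab : Sub a b) (hba : Sub b a) : a = b := by
  obtain ⟨i, hi⟩ := hab
  obtain ⟨j, hj⟩ := hba
  exact IsCatWithSubobjects.strict i j hi hj

theorem isIncl_eqToHom {a b : C} (h : a = b) : IsIncl (eqToHom h) := by
  subst h
  exact IsCatWithSubobjects.id_mem a

theorem IsIncl.eq_eqToHom {a b : C} {j : a ⟶ b} (hj : IsIncl j) (h : a = b) : j = eqToHom h :=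
  IsCatWithSubobjects.unique _ _ hj (isIncl_eqToHom h)

variable {D : Type u} [SmallCategory D] [HasInclusions D] [IsCatWithSubobjects D]

theorem sub_of_sub_obj (F : C ⥤ D) [F.Full] [F.Faithful]
    (map_incl : ∀ {a b : C} (j : a ⟶ b), IsIncl j → IsIncl (F.map j)) {a b c : C}
    (hac : Sub a c) (hbc : Sub b c) (hab : Sub (F.obj a) (F.obj b)) : Sub a b := by
  obtain ⟨i, hi⟩ := hac
  obtain ⟨j, hj⟩ := hbc
  obtain ⟨k, hk⟩ := hab
  have preimage_comp : F.preimage k ≫ j = i := F.map_injective <| by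
    rw [F.map_comp, F.map_preimage]
    exact IsCatWithSubobjects.unique _ _
      (IsCatWithSubobjects.comp_mem _ _ hk (map_incl j hj)) (map_incl i hi)
  exact ⟨F.preimage k, IsCatWithSubobjects.of_comp _ j (by rwa [preimage_comp]) hj⟩

theorem isCatIso_restrictIdeal (F : C ⥤ D) [F.Full] [F.Faithful]
    (map_incl : ∀ {a b : C} (j : a ⟶ b), IsIncl j → IsIncl (F.map j)) (c : C)
    (exists_sub : ∀ d : D, Sub d (F.obj c) → ∃ a : C, Sub a c ∧ F.obj a = d) :
    IsCatIso (restrictIdeal F map_incl c) where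
  bij := by
    constructor
    · rintro ⟨a, ha⟩ ⟨b, hb⟩ hab
      have obj_eq : F.obj a = F.obj b := congrArg ObjectProperty.FullSubcategory.obj hab
      exact ObjectProperty.FullSubcategory.ext <| sub_antisymm
        (sub_of_sub_obj F map_incl ha hb ⟨_, isIncl_eqToHom obj_eq⟩)
        (sub_of_sub_obj F map_incl hb ha ⟨_, isIncl_eqToHom obj_eq.symm⟩)
    · rintro ⟨d, hd⟩
      obtain ⟨a, ha, rfl⟩ := exists_sub d hd
      exact ⟨⟨a, ha⟩, rfl⟩
  full := by
    unfold restrictIdeal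
    infer_instance
  faithful := by
    unfold restrictIdeal
    infer_instance

theorem isLocalIso_of_exists_sub {C D : Type u} [SmallCategory C] [HasInclusions C]
    [IsNormalCategory C] [SmallCategory D] [HasInclusions D] [IsNormalCategory D] (F : C ⥤ D)
    [F.Full] [F.Faithful]
    (map_incl : ∀ {a b : C} (j : a ⟶ b), IsIncl j → IsIncl (F.map j))
    (exists_sub : ∀ (c : C) (d : D), Sub d (F.obj c) → ∃ a : C, Sub a c ∧ F.obj a = d) :
    IsLocalIso F where
  normal_source := inferInstance
  normal_target := inferInstance
  map_incl := map_incl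
  full := inferInstance
  faithful := inferInstance
  iso_ideal c := isCatIso_restrictIdeal F map_incl c (exists_sub c)

end Subobjects

section Cones

variable {C : Type u} [SmallCategory C] [HasInclusions C]

/-- `f` is a morphism of cones from `γ` to `δ`, that is, `δ = γ * f`. No epimorphism is asked for:
`f` splits because some component of `δ` is an isomorphism, see `NormalCone.IsHom.isSplitEpi`. -/
def NormalCone.IsHom (γ δ : NormalCone C) (f : γ.apex ⟶ δ.apex) : Prop :=
  ∀ a, γ.app a ≫ f = δ.app a

namespace NormalCone.IsHom

variable {γ δ : NormalCone C} {f : γ.apex ⟶ δ.apex}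

theorem isSplitEpi (h : γ.IsHom δ f) : IsSplitEpi f := by
  obtain ⟨a, _⟩ := δ.exists_iso
  exact ⟨⟨inv (δ.app a) ≫ γ.app a, by rw [Category.assoc, h a, IsIso.inv_hom_id]⟩⟩

theorem comp {ε : NormalCone C} {g : δ.apex ⟶ ε.apex} (hf : γ.IsHom δ f) (hg : δ.IsHom ε g) :
    γ.IsHom ε (f ≫ g) := fun a => by
  rw [← hg a, ← hf a, Category.assoc]

theorem inv {f : γ.apex ≅ δ.apex} (h : γ.IsHom δ f.hom) : δ.IsHom γ f.inv := fun a => by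
  rw [← h a, Category.assoc, Iso.hom_inv_id, Category.comp_id]

end NormalCone.IsHom

variable [IsNormalCategory C]

instance : SplitEpiCategory C where
  isSplitEpi_of_epi {c d} p _ := by
    obtain ⟨s, hs⟩ := epiPart_split p
    obtain ⟨r, hr⟩ := IsNormalCategory.splits _ (imIncl_incl p)
    have : Epi (imIncl p) := epi_of_epi_fac (epiPart_comp p)
    have section_imIncl : r ≫ imIncl p = 𝟙 d := by
      rw [← cancel_epi (imIncl p), reassoc_of% hr, Category.comp_id]
    refine ⟨⟨r ≫ s, ?_⟩⟩
    calc (r ≫ s) ≫ p = r ≫ (s ≫ epiPart p) ≫ imIncl p := by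
          simp only [Category.assoc, epiPart_comp]
      _ = 𝟙 d := by rw [hs, Category.id_comp, section_imIncl]

namespace NormalCone

theorem isHom_star (γ : NormalCone C) {a : C} (p : γ.apex ⟶ a) [Epi p] :
    γ.IsHom (γ.star p) p := fun _ => rfl

theorem star_congr (γ : NormalCone C) {a b : C} {p : γ.apex ⟶ a} {q : γ.apex ⟶ b} [Epi p] [Epi q]
    (h : a = b) (hpq : p ≫ eqToHom h = q) : γ.star p = γ.star q := by
  subst h
  simp only [eqToHom_refl, Category.comp_id] at hpq
  simp only [hpq]

theorem starEpi_comp_of_epi (γ : NormalCone C) {a d : C} (p : γ.apex ⟶ a) [Epi p] {j : a ⟶ d}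
    (hj : IsIncl j) : γ.starEpi d (p ≫ j) = γ.star p := by
  obtain ⟨h, hp, -⟩ := factor_unique (epiPart (p ≫ j)) (imIncl (p ≫ j)) p j (epiPart_split _)
    ((isSplitEpi_of_epi p).exists_splitEpi.elim fun s => ⟨s.section_, s.id⟩)
    (imIncl_incl _) hj (epiPart_comp _)
  exact γ.star_congr h hp

theorem starEpi_of_epi (γ : NormalCone C) {a : C} (p : γ.apex ⟶ a) [Epi p] :
    γ.starEpi a p = γ.star p := by
  simpa only [Category.comp_id] using
    γ.starEpi_comp_of_epi p (IsCatWithSubobjects.id_mem a)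

theorem IsHom.star_eq {γ δ : NormalCone C} {f : γ.apex ⟶ δ.apex} [Epi f] (h : γ.IsHom δ f) :
    γ.star f = δ :=
  NormalCone.ext rfl (heq_of_eq (funext h))

theorem starEpi_id (γ : NormalCone C) : γ.starEpi γ.apex (𝟙 γ.apex) = γ :=
  (γ.starEpi_of_epi _).trans (IsHom.star_eq fun _ => Category.comp_id _)

theorem starEpi_comp_incl (γ : NormalCone C) {a d : C} (f : γ.apex ⟶ a) {j : a ⟶ d}
    (hj : IsIncl j) : γ.starEpi d (f ≫ j) = γ.starEpi a f := by
  have := γ.starEpi_comp_of_epi (epiPart f)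
    (IsCatWithSubobjects.comp_mem _ _ (imIncl_incl f) hj)
  rwa [reassoc_of% epiPart_comp f] at this

theorem IsHom.starEpi_comp {γ δ : NormalCone C} {f : γ.apex ⟶ δ.apex} (h : γ.IsHom δ f) {c : C}
    (k : δ.apex ⟶ c) : γ.starEpi c (f ≫ k) = δ.starEpi c k := by
  have := h.isSplitEpi
  have star_comp : γ.star (f ≫ epiPart k) = δ.star (epiPart k) :=
    NormalCone.ext rfl (heq_of_eq (funext (h.comp (δ.isHom_star (epiPart k)))))
  calc γ.starEpi c (f ≫ k) = γ.starEpi c ((f ≫ epiPart k) ≫ imIncl k) := by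
        rw [Category.assoc, epiPart_comp]
    _ = γ.star (f ≫ epiPart k) := γ.starEpi_comp_of_epi _ (imIncl_incl k)
    _ = δ.starEpi c k := star_comp

theorem isHom_of_starEpi_eq {γ δ : NormalCone C} {f : γ.apex ⟶ δ.apex}
    (h : γ.starEpi δ.apex f = δ) : γ.IsHom δ f := by
  have im_eq : im f = δ.apex := congrArg NormalCone.apex h
  have : Epi f := by
    rw [← epiPart_comp f, (imIncl_incl f).eq_eqToHom im_eq]
    infer_instance
  have star_eq : γ.star f = δ := (γ.starEpi_of_epi f).symm.trans h
  have app_heq : HEq (γ.star f).app δ.app := by rw [star_eq]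
  exact congrFun (eq_of_heq app_heq)

theorem starEpi_eq_iff {γ δ : NormalCone C} {f : γ.apex ⟶ δ.apex} :
    γ.starEpi δ.apex f = δ ↔ γ.IsHom δ f := by
  refine ⟨isHom_of_starEpi_eq, fun h => ?_⟩
  have := h.isSplitEpi
  rw [starEpi_of_epi, h.star_eq]

end NormalCone

end Cones

section NormalDual

variable {C : Type u} [SmallCategory C] [HasInclusions C]

theorem ConeFunctor.ext_of_coe {F G : ConeFunctor C} (obj_eq : ∀ c, F.obj c = G.obj c)
    (coe_map : ∀ {c d : C} (g : c ⟶ d) (x : F.obj c) (y : G.obj c), x.1 = y.1 →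
      (F.map g x).1 = (G.map g y).1) : F = G := by
  obtain ⟨Fobj, Fmap, _, _⟩ := F
  obtain ⟨Gobj, Gmap, _, _⟩ := G
  obtain rfl : Fobj = Gobj := funext obj_eq
  obtain rfl : @Fmap = @Gmap := by
    funext c d g x
    exact Subtype.ext (coe_map g x x rfl)
  rfl

variable [IsNormalCategory C]

namespace NormalDual

variable {F G K : NormalDual C}

theorem hom_ext {σ τ : F ⟶ G} (h : ∀ c x, comp σ c x = comp τ c x) : σ = τ := by
  refine NormalDual.Hom.ext ?_
  ext c x
  exact h c x

theorem comp_id (c : C) (x : F.fn.obj c) : comp (𝟙 F) c x = x := rfl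

theorem comp_comp (σ : F ⟶ G) (τ : G ⟶ K) (c : C) (x : F.fn.obj c) :
    comp (σ ≫ τ) c x = comp τ c (comp σ c x) := rfl

theorem comp_map (σ : F ⟶ G) {c d : C} (g : c ⟶ d) (x : F.fn.obj c) :
    comp σ d (F.fn.map g x) = G.fn.map g (comp σ c x) :=
  ConcreteCategory.congr_hom (σ.nat.naturality g) x

theorem coe_comp {σ : F ⟶ G} (hσ : IsIncl σ) (c : C) (x : F.fn.obj c) :
    (comp σ c x).1 = x.1 := hσ c x

theorem obj_subset {σ : F ⟶ G} (hσ : IsIncl σ) (c : C) : F.fn.obj c ⊆ G.fn.obj c := fun x hx => by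
  simpa only [coe_comp hσ] using (comp σ c ⟨x, hx⟩).2

theorem eq_of_isIncl {σ : F ⟶ G} {τ : G ⟶ F} (hσ : IsIncl σ) (hτ : IsIncl τ) : F = G := by
  have fn_eq : F.fn = G.fn := ConeFunctor.ext_of_coe
    (fun c => (obj_subset hσ c).antisymm (obj_subset hτ c)) fun {c d} g x y hxy => by
      obtain rfl : comp σ c x = y := Subtype.ext ((hσ c x).trans hxy)
      rw [← comp_map, coe_comp hσ]
  cases F
  cases G
  cases fn_eq
  rfl

end NormalDual

instance : IsCatWithSubobjects (NormalDual C) where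
  id_mem _ := fun _ _ => rfl
  comp_mem _ _ hσ hτ := fun c x => (hτ c _).trans (hσ c x)
  unique _ _ hσ hτ := NormalDual.hom_ext fun c x => Subtype.ext ((hσ c x).trans (hτ c x).symm)
  strict _ _ hσ hτ := NormalDual.eq_of_isIncl hσ hτ
  mono σ hσ := ⟨fun h k e => NormalDual.hom_ext fun c x => Subtype.ext <| by
    have := congrArg (fun t => (NormalDual.comp t c x).1) e
    simpa only [NormalDual.comp_comp, NormalDual.coe_comp hσ] using this⟩
  of_comp _ _ hhg hg := fun c x => (hg c _).symm.trans (hhg c x)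

/-- The element `γ * k°` of `H(γ; c)`. -/
def NormalCone.elt (γ : NormalCone C) {c : C} (k : γ.apex ⟶ c) : γ.HObj.fn.obj c :=
  γ.starEquiv c k

namespace NormalCone

theorem coe_elt (γ : NormalCone C) {c : C} (k : γ.apex ⟶ c) : (γ.elt k).1 = γ.starEpi c k := rfl

theorem elt_injective (γ : NormalCone C) (c : C) :
    Function.Injective (γ.elt : (γ.apex ⟶ c) → γ.HObj.fn.obj c) :=
  (γ.starEquiv c).injective

theorem exists_elt_eq (γ : NormalCone C) {c : C} (x : γ.HObj.fn.obj c) : ∃ k, γ.elt k = x :=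
  (γ.starEquiv c).surjective x

theorem map_elt (γ : NormalCone C) {c d : C} (k : γ.apex ⟶ c) (g : c ⟶ d) :
    γ.HObj.fn.map g (γ.elt k) = γ.elt (k ≫ g) :=
  congrArg (fun k => γ.starEquiv d (k ≫ g)) ((γ.starEquiv c).symm_apply_apply k)

end NormalCone

/-- The morphism `η_γ C(f, -) η_δ⁻¹` from `H(γ; -)` to `H(δ; -)` given by `f : c_δ ⟶ c_γ`; for
principal cones and the morphism `r(f, u, e)` it is `transported e u f`. -/
def dualMap (γ δ : NormalCone C) (f : δ.apex ⟶ γ.apex) : γ.HObj ⟶ δ.HObj :=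
  NormalDual.Hom.mk (γ.η.hom ≫ coyoneda.map f.op ≫ δ.η.inv)

section DualMap

variable {γ δ ε : NormalCone C}

theorem comp_dualMap_elt (f : δ.apex ⟶ γ.apex) {c : C} (k : γ.apex ⟶ c) :
    NormalDual.comp (dualMap γ δ f) c (γ.elt k) = δ.elt (f ≫ k) :=
  congrArg (fun k => δ.starEquiv c (f ≫ k)) ((γ.starEquiv c).symm_apply_apply k)

theorem NormalDual.hom_ext_elt {G : NormalDual C} {σ τ : γ.HObj ⟶ G}
    (h : NormalDual.comp σ _ (γ.elt (𝟙 γ.apex)) = NormalDual.comp τ _ (γ.elt (𝟙 γ.apex))) :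
    σ = τ :=
  NormalDual.hom_ext fun c x => by
    obtain ⟨k, rfl⟩ := γ.exists_elt_eq x
    rw [← Category.id_comp k, ← γ.map_elt, NormalDual.comp_map, NormalDual.comp_map, h]

theorem dualMap_id : dualMap γ γ (𝟙 γ.apex) = 𝟙 γ.HObj :=
  NormalDual.hom_ext_elt <| by rw [comp_dualMap_elt, NormalDual.comp_id, Category.id_comp]

theorem dualMap_comp (f : δ.apex ⟶ γ.apex) (g : ε.apex ⟶ δ.apex) :
    dualMap γ δ f ≫ dualMap δ ε g = dualMap γ ε (g ≫ f) :=
  NormalDual.hom_ext_elt <| by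
    rw [NormalDual.comp_comp, comp_dualMap_elt, comp_dualMap_elt, comp_dualMap_elt,
      Category.assoc]

theorem dualMap_injective : Function.Injective (dualMap γ δ) := fun f g h => by
  have := congrArg (fun σ => NormalDual.comp σ _ (γ.elt (𝟙 γ.apex))) h
  simp only [comp_dualMap_elt, Category.comp_id] at this
  exact δ.elt_injective _ this

theorem dualMap_surjective : Function.Surjective (dualMap γ δ) := fun σ => by
  obtain ⟨f, hf⟩ := δ.exists_elt_eq (NormalDual.comp σ _ (γ.elt (𝟙 γ.apex)))
  exact ⟨f, NormalDual.hom_ext_elt <| by rw [comp_dualMap_elt, Category.comp_id, hf]⟩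

theorem isIncl_dualMap_iff {f : δ.apex ⟶ γ.apex} : IsIncl (dualMap γ δ f) ↔ δ.IsHom γ f := by
  refine ⟨fun h => ?_, fun h c x => ?_⟩
  · have coe_id := h _ (γ.elt (𝟙 γ.apex))
    rw [comp_dualMap_elt, Category.comp_id, NormalCone.coe_elt, NormalCone.coe_elt,
      γ.starEpi_id] at coe_id
    exact NormalCone.starEpi_eq_iff.1 coe_id
  · obtain ⟨k, rfl⟩ := γ.exists_elt_eq x
    rw [comp_dualMap_elt, NormalCone.coe_elt, NormalCone.coe_elt, h.starEpi_comp]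

theorem NormalCone.IsHom.sub_HObj {f : δ.apex ⟶ γ.apex} (h : δ.IsHom γ f) :
    Sub γ.HObj δ.HObj :=
  ⟨_, isIncl_dualMap_iff.2 h⟩

theorem NormalCone.IsHom.HObj_eq {f : δ.apex ≅ γ.apex} (h : δ.IsHom γ f.hom) :
    δ.HObj = γ.HObj :=
  sub_antisymm h.inv.sub_HObj h.sub_HObj

end DualMap

theorem NormalDual.exists_idempotent (F : NormalDual C) :
    ∃ ε : NormalCone C, ε.app ε.apex = 𝟙 ε.apex ∧ F = ε.HObj := by
  obtain ⟨_, γ, rfl⟩ := F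
  obtain ⟨c, _⟩ := γ.exists_iso
  exact ⟨γ.star (inv (γ.app c)), IsIso.hom_inv_id (γ.app c),
    NormalCone.IsHom.HObj_eq (f := (asIso (γ.app c)).symm) (γ.isHom_star (inv (γ.app c)))⟩

theorem exists_comp_eq_starEpi (ε : NormalCone C) (F : NormalDual C) :
    ∃ σ : F ⟶ ε.HObj, ∀ c x, (NormalDual.comp σ c x).1 = ε.starEpi _ (x.1.app ε.apex) := by
  obtain ⟨_, γ, rfl⟩ := F
  refine ⟨dualMap γ ε (γ.app ε.apex), fun c x => ?_⟩
  obtain ⟨k, rfl⟩ := γ.exists_elt_eq x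
  rw [comp_dualMap_elt, NormalCone.coe_elt, ← epiPart_comp k, ← Category.assoc,
    ε.starEpi_comp_incl _ (imIncl_incl k), epiPart_comp]
  rfl

/-- The morphism `F ⟶ H(ε; -)` sending a cone `δ` to `ε * δ(c_ε)°`. This description involves no
choice of a cone `γ` with `F = H(γ; -)`, so these morphisms are compatible with inclusions. -/
def evalAt (ε : NormalCone C) (F : NormalDual C) : F ⟶ ε.HObj :=
  (exists_comp_eq_starEpi ε F).choose

theorem coe_comp_evalAt (ε : NormalCone C) (F : NormalDual C) (c : C) (x : F.fn.obj c) :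
    (NormalDual.comp (evalAt ε F) c x).1 = ε.starEpi _ (x.1.app ε.apex) :=
  (exists_comp_eq_starEpi ε F).choose_spec c x

theorem evalAt_HObj {ε : NormalCone C} (hε : ε.app ε.apex = 𝟙 ε.apex) :
    evalAt ε ε.HObj = 𝟙 ε.HObj :=
  NormalDual.hom_ext_elt <| Subtype.ext <| by
    rw [coe_comp_evalAt, NormalDual.comp_id, NormalCone.coe_elt]
    have starEpi_app : ∀ δ, δ = ε → ε.starEpi _ (δ.app ε.apex) = δ := by
      rintro _ rfl
      rw [hε, NormalCone.starEpi_id]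
    exact starEpi_app _ ε.starEpi_id

/-- The normal cone in the normal dual whose apex is `H(ε; -)`, for an idempotent cone `ε`. -/
def dualCone (ε : NormalCone C) (hε : ε.app ε.apex = 𝟙 ε.apex) : NormalCone (NormalDual C) where
  apex := ε.HObj
  app := evalAt ε
  incl_comp j hj := NormalDual.hom_ext fun c x => Subtype.ext <| by
    rw [NormalDual.comp_comp, coe_comp_evalAt, coe_comp_evalAt, NormalDual.coe_comp hj]
  exists_iso := ⟨ε.HObj, by rw [evalAt_HObj hε]; infer_instance⟩

/-- The normal factorization of the dual of a morphism `p u j` of apexes, where `p` and a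
retraction `q` of `j` are morphisms of cones. -/
def normalFactorizationDualMap {γ δ γ' δ' : NormalCone C} {p : δ.apex ⟶ δ'.apex}
    (hp : δ.IsHom δ' p) {q : γ.apex ⟶ γ'.apex} (hq : γ.IsHom γ' q) (u : δ'.apex ≅ γ'.apex)
    {j : γ'.apex ⟶ γ.apex} (hjq : j ≫ q = 𝟙 γ'.apex) :
    NormalFactorization (dualMap γ δ (p ≫ u.hom ≫ j)) where
  mid := γ'.HObj
  im := δ'.HObj
  q := dualMap γ γ' j
  u := dualMap γ' δ' u.hom
  j := dualMap δ' δ p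
  retraction := ⟨dualMap γ' γ q, isIncl_dualMap_iff.2 hq, by rw [dualMap_comp, hjq, dualMap_id]⟩
  iso := ⟨dualMap δ' γ' u.inv, by rw [dualMap_comp, u.inv_hom_id, dualMap_id], by
    rw [dualMap_comp, u.hom_inv_id, dualMap_id]⟩
  inclusion := isIncl_dualMap_iff.2 hp
  fac := by rw [dualMap_comp, dualMap_comp, Category.assoc]

theorem nonempty_normalFactorization_dualMap (γ δ : NormalCone C) (f : δ.apex ⟶ γ.apex) :
    Nonempty (NormalFactorization (dualMap γ δ f)) := by
  obtain ⟨q, hq⟩ := IsNormalCategory.splits _ (imIncl_incl f)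
  have : IsSplitEpi q := ⟨⟨⟨_, hq⟩⟩⟩
  have factorization := normalFactorizationDualMap (δ.isHom_star (epiPart f)) (γ.isHom_star q)
    (Iso.refl (im f)) hq
  have fac : epiPart f ≫ 𝟙 (im f) ≫ imIncl f = f := by rw [Category.id_comp, epiPart_comp]
  exact ⟨fac ▸ factorization⟩

instance : IsNormalCategory (NormalDual C) where
  factorization {F G} σ := by
    obtain ⟨_, γ, rfl⟩ := F
    obtain ⟨_, δ, rfl⟩ := G
    obtain ⟨f, rfl⟩ := dualMap_surjective σ
    exact nonempty_normalFactorization_dualMap γ δ f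
  splits {F G} σ hσ := by
    obtain ⟨_, γ, rfl⟩ := F
    obtain ⟨_, δ, rfl⟩ := G
    obtain ⟨f, rfl⟩ := dualMap_surjective σ
    have := (isIncl_dualMap_iff.1 hσ).isSplitEpi
    exact ⟨dualMap δ γ (section_ f), by rw [dualMap_comp, IsSplitEpi.id, dualMap_id]⟩
  cone F := by
    obtain ⟨ε, hε, rfl⟩ := F.exists_idempotent
    exact ⟨dualCone ε hε, rfl, evalAt_HObj hε⟩

end NormalDual

section Morphisms

variable {S : Type u} [Semigroup S]

theorem exists_opE (e : E Sᵐᵒᵖ) : ∃ f : E S, opE f = e :=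
  ⟨⟨e.1.unop, congrArg MulOpposite.unop e.2⟩, rfl⟩

theorem InESF.mul {e f g : E S} {u v : S} (hu : InESF e u f) (hv : InESF f v g) :
    InESF e (u * v) g :=
  InESF.of (by rw [← mul_assoc, hu.left]) (by rw [mul_assoc, hv.right])

theorem inESF_of_omegaR {e f : E S} (h : omegaR e f) : InESF f e.1 e := InESF.of h e.2

theorem LG.inESF_val {a b : LG S} (e f : E S) (he : LG.mk' e = a) (hf : LG.mk' f = b)
    (m : a ⟶ b) : InESF e (LG.val e he m) f :=
  InESF.of (LG.mul_val e he m) (LG.val_mul e f he hf m)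

theorem RG.exists_rep (a : RG S) : ∃ e : E S, RG.mk' e = a := by
  obtain ⟨e, rfl⟩ := LG.exists_rep a
  obtain ⟨f, rfl⟩ := exists_opE e
  exact ⟨f, rfl⟩

/-- A representative in `E(S)` of an object of `ℛ_G`. -/
def RG.rep (a : RG S) : E S := (RG.exists_rep a).choose

theorem RG.rep_spec (a : RG S) : RG.mk' a.rep = a := (RG.exists_rep a).choose_spec

theorem RG.mk'_eq {e f : E S} : RG.mk' e = RG.mk' f ↔ omegaR e f ∧ omegaR f e :=
  LG.mk'_eq.trans (and_congr MulOpposite.op_injective.eq_iff MulOpposite.op_injective.eq_iff)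

/-- The middle entry `u` of a morphism `l(e, u, f)` of `ℛ_G`, for a representative `e` of its
domain, as an element of `S` rather than of the opposite semigroup. -/
def RG.val {a b : RG S} (e : E S) (he : RG.mk' e = a) (m : a ⟶ b) : S :=
  (LG.val (opE e) he m).unop

theorem RG.inESF_val {a b : RG S} (e f : E S) (he : RG.mk' e = a) (hf : RG.mk' f = b)
    (m : a ⟶ b) : InESF f (RG.val e he m) e :=
  InESF.of (congrArg MulOpposite.unop (LG.val_mul (opE e) (opE f) he hf m))
    (congrArg MulOpposite.unop (LG.mul_val (opE e) he m))

theorem RG.val_comp {a b c : RG S} (e f : E S) (he : RG.mk' e = a) (hf : RG.mk' f = b)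
    (m : a ⟶ b) (n : b ⟶ c) : RG.val e he (m ≫ n) = RG.val f hf n * RG.val e he m :=
  congrArg MulOpposite.unop (LG.val_comp (opE e) (opE f) he hf m n)

theorem RG.isIncl_iff {a b : RG S} (m : a ⟶ b) : IsIncl m ↔ ∀ e he, RG.val e he m = e.1 := by
  rw [LG.isIncl_iff]
  refine ⟨fun h e he => congrArg MulOpposite.unop (h (opE e) he), fun h e he => ?_⟩
  obtain ⟨e, rfl⟩ := exists_opE e
  exact MulOpposite.unop_injective (h e he)

variable [IsRegularSemigroup S]

theorem LG.val_r_self {a b : LG S} (e : E S) (u : S) (f : E S) (he : LG.mk' e = a)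
    (hf : LG.mk' f = b) (hu : InESF e u f) : LG.val e he (LG.r e u f he hf hu) = u := by
  rw [LG.val_r, hu.left]

theorem LG.exists_eq_r {a b : LG S} (e f : E S) (he : LG.mk' e = a) (hf : LG.mk' f = b)
    (m : a ⟶ b) : ∃ u hu, m = LG.r e u f he hf hu :=
  ⟨_, LG.inESF_val e f he hf m, LG.hom_ext e he (LG.val_r_self _ _ _ _ _ _).symm⟩

theorem LG.r_comp {a b c : LG S} (e f g : E S) (u v : S) (he : LG.mk' e = a)
    (hf : LG.mk' f = b) (hg : LG.mk' g = c) (hu : InESF e u f) (hv : InESF f v g) :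
    LG.r e u f he hf hu ≫ LG.r f v g hf hg hv = LG.r e (u * v) g he hg (hu.mul hv) := by
  apply LG.hom_ext e he
  rw [LG.val_comp e f he hf, LG.val_r_self, LG.val_r_self, LG.val_r_self]

theorem LG.r_id {a : LG S} (e : E S) (he : LG.mk' e = a) (h : InESF e e.1 e) :
    LG.r e e.1 e he he h = 𝟙 a :=
  LG.hom_ext e he (by rw [LG.val_r_self, LG.val_id])

theorem LG.r_comp_eq_id {a b : LG S} {e f : E S} {u v : S} (he : LG.mk' e = a)
    (hf : LG.mk' f = b) (hu : InESF e u f) (hv : InESF f v e) (huv : u * v = e.1) :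
    LG.r e u f he hf hu ≫ LG.r f v e hf he hv = 𝟙 a :=
  LG.hom_ext e he (by rw [LG.r_comp, LG.val_r_self, LG.val_id, huv])

theorem RG.exists_eq_l {e f : E S} (m : RG.mk' e ⟶ RG.mk' f) : ∃ u hu, m = RG.l e u f hu :=
  ⟨_, RG.inESF_val e f rfl rfl m, LG.hom_ext (opE e) rfl (LG.val_r_self _ _ _ _ _ _).symm⟩

theorem RG.val_l {e f : E S} {u : S} (hu : InESF f u e) (g : E S) (hg : RG.mk' g = RG.mk' e) :
    RG.val g hg (RG.l e u f hu) = u * g.1 :=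
  congrArg MulOpposite.unop (LG.val_r _ _ _ _ _ _ _ _)

theorem RG.isIncl_l {e f : E S} (h : omegaR e f) :
    IsIncl (RG.l e e.1 f (inESF_of_omegaR h)) :=
  (RG.isIncl_iff _).2 fun g hg => (RG.val_l _ g hg).trans (RG.mk'_eq.1 hg).1

theorem RG.sub_iff {e f : E S} : Sub (RG.mk' e) (RG.mk' f) ↔ omegaR e f := by
  refine ⟨?_, fun h => ⟨_, RG.isIncl_l h⟩⟩
  rintro ⟨j, hj⟩
  have := (RG.inESF_val e f rfl rfl j).left
  rwa [(RG.isIncl_iff j).1 hj] at this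

end Morphisms

section PrincipalCones

variable {S : Type u} [Semigroup S] [IsRegularSemigroup S]

theorem isHom_rCone_iff {e : E S} {γ : NormalCone (LG S)} {m : (rCone e).apex ⟶ γ.apex} :
    (rCone e).IsHom γ m ↔
      ∀ a g hg, LG.val g hg (γ.app a) = g.1 * LG.val (a := LG.mk' e) e rfl m := by
  have val_comp (a : LG S) (g : E S) (hg : LG.mk' g = a) :
      LG.val g hg ((rCone e).app a ≫ m) = g.1 * LG.val (a := LG.mk' e) e rfl m := by
    rw [LG.val_comp g e hg rfl, LG.val_rCone, mul_assoc, LG.mul_val]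
  constructor
  · intro h a g hg
    rw [← h a, val_comp]
  · intro h a
    obtain ⟨g, hg⟩ := LG.exists_rep a
    exact LG.hom_ext g hg ((val_comp a g hg).trans (h a g hg).symm)

theorem isHom_rCone_of_omegaR {e f : E S} (h : omegaR e f) :
    (rCone f).IsHom (rCone e) (LG.r f e.1 e rfl rfl (inESF_of_omegaR h)) :=
  isHom_rCone_iff.2 fun a g hg => by rw [LG.val_rCone, LG.val_r_self]

theorem rCone_app_mk' (e : E S) : (rCone e).app (LG.mk' e) = 𝟙 (LG.mk' e) :=
  LG.hom_ext e rfl ((LG.val_rCone e _ e rfl).trans e.2)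

theorem HObj_rCone_eq {e f : E S} (h : RG.mk' e = RG.mk' f) : (rCone e).HObj = (rCone f).HObj :=
  sub_antisymm (isHom_rCone_of_omegaR (RG.mk'_eq.1 h).1).sub_HObj
    (isHom_rCone_of_omegaR (RG.mk'_eq.1 h).2).sub_HObj

theorem exists_isHom_rCone_iso {f : E S} {γ : NormalCone (LG S)} {p : (rCone f).apex ⟶ γ.apex}
    (hp : (rCone f).IsHom γ p) :
    ∃ e : E S, omegaR e f ∧ ∃ i : (rCone e).apex ≅ γ.apex, (rCone e).IsHom γ i.hom := by
  obtain ⟨h, hh⟩ := LG.exists_rep γ.apex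
  obtain ⟨s, hsp⟩ := hp.isSplitEpi.exists_splitEpi
  obtain ⟨u, hu, rfl⟩ := LG.exists_eq_r f h rfl hh p
  obtain ⟨v, hv, rfl⟩ := LG.exists_eq_r h f hh rfl s
  have hvu : v * u = h.1 := by
    have := congrArg (LG.val h hh) hsp
    rwa [LG.r_comp, LG.val_r_self, LG.val_id] at this
  have huvu : u * v * u = u := by rw [mul_assoc, hvu, hu.right]
  have hvuv : v * (u * v) = v := by rw [← mul_assoc, hvu, hv.left]
  let e : E S := ⟨u * v, by rw [IsIdempotentElem, mul_assoc, hvuv]⟩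
  have hu' : InESF e u h := InESF.of huvu hu.right
  have hv' : InESF h v e := InESF.of hv.left hvuv
  have hef : omegaR e f := (hu.mul hv).left
  refine ⟨e, hef, ⟨LG.r e u h rfl hh hu', LG.r h v e hh rfl hv',
    LG.r_comp_eq_id rfl hh hu' hv' rfl, LG.r_comp_eq_id hh rfl hv' hu' hvu⟩,
    isHom_rCone_iff.2 fun a g hg => ?_⟩
  rw [isHom_rCone_iff.1 hp a g hg, LG.val_r_self, LG.val_r_self]

theorem exists_omegaR_of_sub_HObj {f : E S} {F : NormalDual (LG S)} (hF : Sub F (rCone f).HObj) :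
    ∃ e : E S, omegaR e f ∧ (rCone e).HObj = F := by
  obtain ⟨_, γ, rfl⟩ := F
  obtain ⟨σ, hσ⟩ := hF
  obtain ⟨p, rfl⟩ := dualMap_surjective σ
  obtain ⟨e, he, i, hi⟩ := exists_isHom_rCone_iso (isIncl_dualMap_iff.1 hσ)
  exact ⟨e, he, hi.HObj_eq⟩

end PrincipalCones

section Transported

variable {S : Type u} [Semigroup S] [IsRegularSemigroup S]

theorem transported_comp {e f g : E S} {u v : S} (hu : InESF f u e) (hv : InESF g v f) :
    transported e u f hu ≫ transported f v g hv = transported e (v * u) g (hv.mul hu) :=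
  (dualMap_comp _ _).trans (congrArg (dualMap _ _) (LG.r_comp _ _ _ _ _ _ _ _ _ _))

theorem transported_congr {e f : E S} {u v : S} (hu : InESF f u e) (hv : InESF f v e)
    (h : u = v) : transported e u f hu = transported e v f hv := by
  subst h
  rfl

theorem transported_self {e : E S} (h : InESF e e.1 e) :
    transported e e.1 e h = 𝟙 (rCone e).HObj :=
  (congrArg (dualMap _ _) (LG.r_id e rfl h)).trans dualMap_id

theorem transported_injective {e f : E S} {u v : S} {hu : InESF f u e} {hv : InESF f v e}
    (h : transported e u f hu = transported e v f hv) : u = v := by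
  have := congrArg (LG.val f rfl) (dualMap_injective h)
  rwa [LG.val_r_self, LG.val_r_self] at this

theorem exists_transported {e f : E S} (σ : (rCone e).HObj ⟶ (rCone f).HObj) :
    ∃ u hu, σ = transported e u f hu := by
  obtain ⟨m, rfl⟩ := dualMap_surjective σ
  obtain ⟨u, hu, rfl⟩ := LG.exists_eq_r f e rfl rfl m
  exact ⟨u, hu, rfl⟩

theorem isIncl_transported {e f : E S} (h : omegaR e f) :
    IsIncl (transported e e.1 f (inESF_of_omegaR h)) :=
  isIncl_dualMap_iff.2 (isHom_rCone_of_omegaR h)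

theorem eqToHom_HObj {e f : E S} (h : RG.mk' e = RG.mk' f)
    (hH : (rCone e).HObj = (rCone f).HObj) :
    eqToHom hH = transported e e.1 f (inESF_of_omegaR (RG.mk'_eq.1 h).1) :=
  ((isIncl_transported (RG.mk'_eq.1 h).1).eq_eqToHom hH).symm

theorem transported_eq_eqToHom_comp {e e' f f' : E S} (he : RG.mk' e' = RG.mk' e)
    (hf : RG.mk' f' = RG.mk' f) {u v : S} (hu : InESF f u e) (hv : InESF f' v e')
    (huv : v = u * e'.1) :
    transported e' v f' hv = eqToHom (HObj_rCone_eq he) ≫ transported e u f hu ≫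
      eqToHom (HObj_rCone_eq hf.symm) := by
  rw [eqToHom_HObj he, eqToHom_HObj hf.symm, transported_comp, transported_comp]
  exact transported_congr _ _ (by rw [huv, hu.left])

end Transported

section GammaG

variable {S : Type u} [Semigroup S] [IsRegularSemigroup S]

variable (S) in
/-- The functor `Γ_G`. -/
def gammaG : RG S ⥤ NormalDual (LG S) where
  obj a := (rCone a.rep).HObj
  map {a b} m := transported a.rep (RG.val a.rep a.rep_spec m) b.rep
    (RG.inESF_val _ _ a.rep_spec b.rep_spec m)
  map_id a := transported_self (inESF_of_omegaR a.rep.2)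
  map_comp {a b c} m n := by
    rw [transported_comp]
    exact transported_congr _ _ (RG.val_comp _ _ a.rep_spec b.rep_spec m n)

theorem isGammaG_gammaG : IsGammaG (gammaG S) where
  obj_eq e := HObj_rCone_eq (RG.mk' e).rep_spec
  map_eq e _ f hu := transported_eq_eqToHom_comp (RG.mk' e).rep_spec (RG.mk' f).rep_spec hu _
    (RG.val_l hu _ (RG.mk' e).rep_spec)

namespace IsGammaG

variable {Γ Γ' : RG S ⥤ NormalDual (LG S)}

theorem eq_of_isGammaG (h : IsGammaG Γ) (h' : IsGammaG Γ') : Γ = Γ' := by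
  refine CategoryTheory.Functor.ext (fun a => ?_) fun a b m => ?_
  · obtain ⟨e, rfl⟩ := RG.exists_rep a
    rw [h.obj_eq, h'.obj_eq]
  · obtain ⟨e, rfl⟩ := RG.exists_rep a
    obtain ⟨f, rfl⟩ := RG.exists_rep b
    obtain ⟨u, hu, rfl⟩ := RG.exists_eq_l m
    rw [h.map_eq, h'.map_eq]
    simp only [Category.assoc, eqToHom_trans, eqToHom_trans_assoc]

theorem map_isIncl (h : IsGammaG Γ) {a b : RG S} (j : a ⟶ b) (hj : IsIncl j) :
    IsIncl (Γ.map j) := by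
  obtain ⟨e, rfl⟩ := RG.exists_rep a
  obtain ⟨f, rfl⟩ := RG.exists_rep b
  have hef : omegaR e f := RG.sub_iff.1 ⟨j, hj⟩
  obtain rfl := IsCatWithSubobjects.unique _ _ hj (RG.isIncl_l hef)
  rw [h.map_eq]
  exact IsCatWithSubobjects.comp_mem _ _ (isIncl_eqToHom _) <|
    IsCatWithSubobjects.comp_mem _ _ (isIncl_transported hef) (isIncl_eqToHom _)

theorem full (h : IsGammaG Γ) : Γ.Full where
  map_surjective {a b} σ := by
    obtain ⟨e, rfl⟩ := RG.exists_rep a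
    obtain ⟨f, rfl⟩ := RG.exists_rep b
    obtain ⟨u, hu, hσ⟩ := exists_transported
      (eqToHom (h.obj_eq e).symm ≫ σ ≫ eqToHom (h.obj_eq f))
    refine ⟨RG.l e u f hu, ?_⟩
    rw [h.map_eq, ← hσ]
    simp only [Category.assoc, eqToHom_trans, eqToHom_trans_assoc, eqToHom_refl,
      Category.comp_id, Category.id_comp]

theorem faithful (h : IsGammaG Γ) : Γ.Faithful where
  map_injective {a b} m n hmn := by
    obtain ⟨e, rfl⟩ := RG.exists_rep a
    obtain ⟨f, rfl⟩ := RG.exists_rep b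
    obtain ⟨u, hu, rfl⟩ := RG.exists_eq_l m
    obtain ⟨v, hv, rfl⟩ := RG.exists_eq_l n
    rw [h.map_eq, h.map_eq, cancel_epi, cancel_mono] at hmn
    obtain rfl := transported_injective hmn
    rfl

theorem isLocalIso (h : IsGammaG Γ) : IsLocalIso Γ := by
  have := h.full
  have := h.faithful
  refine isLocalIso_of_exists_sub Γ h.map_isIncl fun c F hF => ?_
  obtain ⟨f, rfl⟩ := RG.exists_rep c
  rw [h.obj_eq] at hF
  obtain ⟨e, he, rfl⟩ := exists_omegaR_of_sub_HObj hF
  exact ⟨RG.mk' e, RG.sub_iff.2 he, h.obj_eq e⟩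

theorem isCrossConnection (h : IsGammaG Γ) : IsCrossConnection Γ where
  normal_source := inferInstance
  localIso := h.isLocalIso
  exists_mem_M c := by
    obtain ⟨e, rfl⟩ := LG.exists_rep c
    refine ⟨RG.mk' e, rCone e, by rw [h.obj_eq], ?_⟩
    rw [NormalCone.M, Set.mem_ofPred_eq, rCone_app_mk']
    infer_instance

end IsGammaG

end GammaG

end CrossConn

end

/-- For a regular semigroup `S`, the equations `Γ_G(class of e) = H(r^e; -)` and
`Γ_G(l(e, u, f)) = η_{r^e} ℒ_G(r(f, u, e), -) η_{r^f}⁻¹` define a functor from `ℛ_G` to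
`N*ℒ_G`, and this functor is a cross-connection. -/
theorem mainTheorem4 (S : Type u) [Semigroup S] [CrossConn.IsRegularSemigroup S] :
    (∃! Γ : CrossConn.RG S ⥤ CrossConn.NormalDual (CrossConn.LG S), CrossConn.IsGammaG Γ) ∧
      ∀ Γ : CrossConn.RG S ⥤ CrossConn.NormalDual (CrossConn.LG S),
        CrossConn.IsGammaG Γ → CrossConn.IsCrossConnection Γ :=
  ⟨⟨CrossConn.gammaG S, CrossConn.isGammaG_gammaG,
    fun _ h => h.eq_of_isGammaG CrossConn.isGammaG_gammaG⟩, fun _ h => h.isCrossConnection⟩
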